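/- Let $N\ge 2$ and let $\Omega\subset\mathbb R^N$ be a domain that is radially symmetric with respect to the origin (for instance a ball, an annulus, or the exterior of a ball). Functions on $\Omega$ are extended by $0$ to $\mathbb R^N$, and equalities between functions are understood almost everywhere. For an open half-space $H$ with $0\in\partial H$ let $\sigma_H$ be the reflection in $\partial H$, put $(\sigma_H u)(x)=u(\sigma_H x)$, and let $$u_H(x)=\begin{cases}\max\{u(x),u(\sigma_Hx)\}, & x\in H,\\ \min\{u(x),u(\sigma_Hx)\}, & x\notin H,\end{cases}$$ be the two-point rearrangement of $u$. The foliated Schwarz symmetrization $u^*$ of a measurable $u:\Omega\to\mathbb R$ is the (a.e. unique) function of the form $u^*(x)=w(|x|,\arccos(x_1/|x|))$, with $w(r,\theta)$ real-valued and nonincreasing in $\theta\in(0,\pi)$ for every $r \geq 0$, such that for almost every $r>0$ and all real $a<b$ the sets $\{x\in\Omega: |x|=r,\ a<u(x)\le b\}$ and $\{x\in\Omega: |x|=r,\ a<u^*(x)\le b\}$ have the same $(N-1)$-dimensional surface measure. The function $u$ is called foliated Schwarz symmetric with respect to a point $P$ of the unit sphere $\mathcal S^{N-1}$ if there is a rotation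 $\rho$ about the origin with $\rho(1,0,\dots,0)=P$ and $u\circ\rho=u^*$. **Theorem.** Let $u\in L^p(\Omega)$ for some $1\le p<\infty$, and suppose that for every open half-space $H$ with $0\in\partial H$ one has $u=u_H$ or $\sigma_Hu=u_H$. Then $u$ is foliated Schwarz symmetric with respect to some point $P\in\mathcal S^{N-1}$. -/

import Mathlib

open MeasureTheory

namespace FoliatedSchwarz

/-- A domain (open, connected, nonempty) that is radially symmetric about the origin: a ball, an
annulus, the exterior of a ball (or the whole, possibly punctured, space). -/
structure IsRadialDomain {N : ℕ} (Ω : Set (EuclideanSpace ℝ (Fin N))) : Prop where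
  isOpen : IsOpen Ω
  isConnected : IsConnected Ω
  radial : ∀ x y : EuclideanSpace ℝ (Fin N), ‖x‖ = ‖y‖ → x ∈ Ω → y ∈ Ω

/-- The open half-space with inner normal `e` whose boundary contains the origin. The open
half-spaces with `0` on the boundary are in bijection with the unit vectors `e`. -/
def halfSpace {N : ℕ} (e : EuclideanSpace ℝ (Fin N)) : Set (EuclideanSpace ℝ (Fin N)) :=
  {x | 0 < inner ℝ e x}

/-- The reflection in the boundary hyperplane of `halfSpace e`. -/
noncomputable def sigmaH {N : ℕ} (e : EuclideanSpace ℝ (Fin N)) :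
    EuclideanSpace ℝ (Fin N) ≃ₗᵢ[ℝ] EuclideanSpace ℝ (Fin N) :=
  (Submodule.span ℝ {e})ᗮ.reflection

open Classical in
/-- The two-point rearrangement of `u` with respect to `halfSpace e`. -/
noncomputable def twoPoint {N : ℕ} (e : EuclideanSpace ℝ (Fin N))
    (u : EuclideanSpace ℝ (Fin N) → ℝ) (x : EuclideanSpace ℝ (Fin N)) : ℝ :=
  if x ∈ halfSpace e then max (u x) (u (sigmaH e x)) else min (u x) (u (sigmaH e x))

/-- The north pole `(1, 0, …, 0)` of the unit sphere. -/
noncomputable def northPole (N : ℕ) [NeZero N] : EuclideanSpace ℝ (Fin N) :=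
  EuclideanSpace.single 0 1

/-- `v` is (a version of) the foliated Schwarz symmetrization of `u : Ω → ℝ`: it is a function
`w (r, θ)` of the radius and of the polar angle from the north pole, nonincreasing in `θ`, and on
almost every sphere about the origin it is equimeasurable with `u`.
Monotonicity is asked for `0 < θ < π`: the two poles of a sphere carry no measure, and `u` may be
unbounded near them. `volume.toSphere` is the surface measure of the unit sphere; the sphere of
radius `r` carries its image under `ω ↦ r • ω` multiplied by `r ^ (N - 1)`, a factor that
occurs on both sides. -/
structure IsSymmetrization {N : ℕ} [NeZero N] (Ω : Set (EuclideanSpace ℝ (Fin N)))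
    (u v : EuclideanSpace ℝ (Fin N) → ℝ) : Prop where
  polar : ∃ w : ℝ → ℝ → ℝ,
    (∀ r : ℝ, 0 ≤ r → AntitoneOn (w r) (Set.Ioo 0 Real.pi)) ∧
    ∀ x ∈ Ω, v x = w ‖x‖ (Real.arccos (x 0 / ‖x‖))
  equimeasurable : ∀ᵐ r : ℝ ∂(volume.restrict (Set.Ioi (0 : ℝ))), ∀ a b : ℝ, a < b →
    (volume : Measure (EuclideanSpace ℝ (Fin N))).toSphere
        {ω | r • (ω : EuclideanSpace ℝ (Fin N)) ∈ Ω ∧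
          a < u (r • (ω : EuclideanSpace ℝ (Fin N))) ∧
          u (r • (ω : EuclideanSpace ℝ (Fin N))) ≤ b} =
      (volume : Measure (EuclideanSpace ℝ (Fin N))).toSphere
        {ω | r • (ω : EuclideanSpace ℝ (Fin N)) ∈ Ω ∧
          a < v (r • (ω : EuclideanSpace ℝ (Fin N))) ∧
          v (r • (ω : EuclideanSpace ℝ (Fin N))) ≤ b}

/-- `u : Ω → ℝ` is foliated Schwarz symmetric with respect to `P`: for some rotation `ρ` about the
origin taking the north pole to `P`, the function `u ∘ ρ` agrees almost everywhere on `Ω` with the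
foliated Schwarz symmetrization of `u`. -/
def IsFoliatedSchwarzSymmetric {N : ℕ} [NeZero N] (Ω : Set (EuclideanSpace ℝ (Fin N)))
    (u : EuclideanSpace ℝ (Fin N) → ℝ) (P : EuclideanSpace ℝ (Fin N)) : Prop :=
  ∃ ρ : EuclideanSpace ℝ (Fin N) ≃ₗᵢ[ℝ] EuclideanSpace ℝ (Fin N),
    LinearMap.det (ρ.toLinearEquiv : EuclideanSpace ℝ (Fin N) →ₗ[ℝ] EuclideanSpace ℝ (Fin N)) = 1 ∧
    ρ (northPole N) = P ∧
    ∃ v : EuclideanSpace ℝ (Fin N) → ℝ, IsSymmetrization Ω u v ∧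
      (fun x => u (ρ x)) =ᵐ[volume.restrict Ω] v

end FoliatedSchwarz

/-!
Let `f = arctan ∘ u`, with `u` extended by zero, and let `σ` be the reflection in the hyperplane
orthogonal to `e`. The hypothesis says that `(f x - f (σ x)) * ⟪e, x⟫` has a constant sign almost
everywhere, for each unit vector `e` (`sign_of_twoPoint`).

The direction of symmetry is that of the first moment `M = ∫ f x * weight x • x`, for a positive
radial weight. Indeed `2 * ⟪e, M⟫` is the integral of `(f x - f (σ x)) * ⟪e, x⟫ * weight x`, so its
sign is the constant sign above, and `⟪e, M⟫ = 0` forces `f = f ∘ σ`. Hence, with `P` the direction of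
`M`, the function `f` is polarized in every direction `e` with `0 ≤ ⟪e, P⟫` (`exists_pole`).

The exceptional null sets depend on `e`. They disappear on averaging: a polarized function has the
larger average over a ball on the preferred side than over its mirror image
(`IsPolarized.setIntegral_closedBall_le`), for every ball. Any two points `x ≠ y` of a
sphere about the origin are exchanged by the reflection in direction `x - y`, so the averages, and
their upper limit `F` as the radius shrinks, are on every such sphere nondecreasing functions of
`⟪P, x⟫`; by Lebesgue's differentiation theorem `F = f` almost everywhere
(`exists_ae_eq_monotone`).

A rotation `ρ` takes the north pole to `P`, and `tan ∘ F ∘ ρ`, restricted to a meridian, is the profile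
of the symmetrization. It could fail to be meaningful only where `F` attains `π / 2` or `-π / 2`; as
`F` is monotone and caps have positive measure, polar coordinates exclude this on
almost every sphere (`profile_eq_tan`). Equimeasurability is the rotation invariance of the
surface measure (`equimeasurable_of_ae_eq`).
-/

namespace FoliatedSchwarz

section Polarization

variable {E : Type*} [NormedAddCommGroup E] [InnerProductSpace ℝ E]

/-! ### Reflections and polarized functions -/

/-- The reflection in the hyperplane orthogonal to `e`. -/
noncomputable abbrev hyperplaneReflection (e : E) : E ≃ₗᵢ[ℝ] E :=
  (Submodule.span ℝ {e})ᗮ.reflection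

lemma inner_hyperplaneReflection (e x : E) :
    inner ℝ e (hyperplaneReflection e x) = -inner ℝ e x := by
  have h := (hyperplaneReflection e).inner_map_map e x
  rw [Submodule.reflection_orthogonalComplement_singleton_eq_neg, inner_neg_left] at h
  linarith

lemma hyperplaneReflection_smul {c : ℝ} (hc : c ≠ 0) (e : E) :
    hyperplaneReflection (c • e) = hyperplaneReflection e := by
  unfold hyperplaneReflection
  have h : Submodule.span ℝ {c • e} = Submodule.span ℝ {e} :=
    Submodule.span_singleton_smul_eq hc.isUnit e
  congr! 2

/-- Two points on the same side of a hyperplane are closer to each other than one of them is to the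
mirror image of the other. -/
lemma dist_le_dist_hyperplaneReflection {e x y : E}
    (h : 0 ≤ inner ℝ e x * inner ℝ e y) : dist y x ≤ dist (hyperplaneReflection e y) x := by
  rcases eq_or_ne e 0 with rfl | he
  · rw [show hyperplaneReflection (0 : E) y = y from
      Submodule.reflection_mem_subspace_eq_self (by simp)]
  have key : hyperplaneReflection e y = y - (2 * (inner ℝ e y / ‖e‖ ^ 2)) • e := by
    rw [Submodule.reflection_orthogonal_apply, Submodule.reflection_singleton_apply]
    simp only [RCLike.ofReal_real_eq_id, id, mul_smul, two_smul]
    abel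
  rw [dist_eq_norm, dist_eq_norm]
  refine le_of_sq_le_sq ?_ (norm_nonneg _)
  have h1 : ‖hyperplaneReflection e y - x‖ ^ 2
      = ‖y - x‖ ^ 2 + 4 * (inner ℝ e x * inner ℝ e y) / ‖e‖ ^ 2 := by
    have h2 : hyperplaneReflection e y - x
        = (y - x) - (2 * (inner ℝ e y / ‖e‖ ^ 2)) • e := by rw [key]; abel
    have h3 : ‖e‖ ≠ 0 := norm_ne_zero_iff.2 he
    rw [h2, norm_sub_sq_real, norm_smul, inner_smul_right, inner_sub_left, real_inner_comm e y,
      real_inner_comm e x, mul_pow, Real.norm_eq_abs, sq_abs]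
    field_simp
    ring
  rw [h1]
  have : 0 ≤ 4 * (inner ℝ e x * inner ℝ e y) / ‖e‖ ^ 2 := by positivity
  linarith

/-- A positive radial weight with integrable first moment. -/
noncomputable def weight (x : E) : ℝ :=
  (1 + ‖x‖) ^ (-(Module.finrank ℝ E + 1 : ℝ)) * (1 + ‖x‖)⁻¹

lemma weight_pos (x : E) : 0 < weight x := by
  unfold weight; positivity

variable [FiniteDimensional ℝ E] [MeasurableSpace E] [BorelSpace E]

/-- `f` is polarized in direction `e`: it takes larger values on the side of the hyperplane
orthogonal to `e` into which `e` points. The product with `inner ℝ e x` makes one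
condition serve both sides. -/
def IsPolarized (f : E → ℝ) (e : E) : Prop :=
  ∀ᵐ x, 0 ≤ (f x - f (hyperplaneReflection e x)) * inner ℝ e x

/-- Antisymmetrization of an integral against a kernel `k`. -/
lemma integral_sub_mul_sub_hyperplaneReflection {f k : E → ℝ} (e : E)
    (h₁ : Integrable fun x => f x * k x)
    (h₂ : Integrable fun x => f x * k (hyperplaneReflection e x)) :
    ∫ x, (f x - f (hyperplaneReflection e x)) * (k x - k (hyperplaneReflection e x)) =
      2 * ((∫ x, f x * k x) - ∫ x, f x * k (hyperplaneReflection e x)) := by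
  have hσ := (hyperplaneReflection e).measurePreserving
  have hemb := (hyperplaneReflection e).toHomeomorph.measurableEmbedding
  have h₃ : Integrable fun x => f (hyperplaneReflection e x) * k (hyperplaneReflection e x) :=
    (hσ.integrable_comp_emb hemb).2 h₁
  have h₄ : Integrable fun x => f (hyperplaneReflection e x) * k x := by
    simpa [Function.comp_def] using (hσ.integrable_comp_emb hemb).2 h₂
  have i₃ : ∫ x, f (hyperplaneReflection e x) * k (hyperplaneReflection e x) = ∫ x, f x * k x :=
    hσ.integral_comp hemb fun x => f x * k x
  have i₄ : ∫ x, f (hyperplaneReflection e x) * k x =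
      ∫ x, f x * k (hyperplaneReflection e x) := by
    simpa using hσ.integral_comp hemb fun x => f x * k (hyperplaneReflection e x)
  calc _ = ∫ x, ((f x * k x + f (hyperplaneReflection e x) * k (hyperplaneReflection e x))
          - (f x * k (hyperplaneReflection e x) + f (hyperplaneReflection e x) * k x)) := by
        congr 1; ext x; ring
    _ = _ := by
        rw [integral_sub (by exact h₁.add h₃) (by exact h₂.add h₄),
          integral_add h₁ h₃, integral_add h₂ h₄, i₃, i₄]
        ring

/-! ### The weighted first moment -/

/-- The weighted first moment (barycentre) of `f`. -/
noncomputable def moment (f : E → ℝ) : E := ∫ x, (f x * weight x) • x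

lemma integrable_moment {f : E → ℝ} {C : ℝ} (hf : AEStronglyMeasurable f)
    (hC : ∀ x, |f x| ≤ C) : Integrable fun x => (f x * weight x) • x := by
  have h0 : Integrable fun x : E => C * (1 + ‖x‖) ^ (-(Module.finrank ℝ E + 1 : ℝ)) :=
    (integrable_one_add_norm (by linarith)).const_mul C
  refine h0.mono' ?_ (.of_forall fun x => ?_)
  · have : Measurable (weight : E → ℝ) := by unfold weight; fun_prop
    exact (hf.mul this.aestronglyMeasurable).smul aestronglyMeasurable_id
  · have h1 : (1 + ‖x‖)⁻¹ * ‖x‖ ≤ 1 := by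
      rw [inv_mul_le_one₀ (by positivity)]; linarith
    have h2 : 0 ≤ (1 + ‖x‖) ^ (-(Module.finrank ℝ E + 1 : ℝ)) := by positivity
    rw [norm_smul, norm_mul, Real.norm_eq_abs, Real.norm_eq_abs, abs_of_pos (weight_pos x), weight]
    calc _ = |f x| * ((1 + ‖x‖) ^ (-(Module.finrank ℝ E + 1 : ℝ)) * ((1 + ‖x‖)⁻¹ * ‖x‖)) := by ring
      _ ≤ C * ((1 + ‖x‖) ^ (-(Module.finrank ℝ E + 1 : ℝ)) * 1) := by
        gcongr
        · exact (abs_nonneg _).trans (hC x)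
        · exact hC x
      _ = _ := by ring

/-- The sign of `inner ℝ e (moment f)` decides in which of the two directions `e`, `-e` the function
is polarized: this inner product is, up to a positive factor, the integral of the function
`(f - f ∘ σ) * inner ℝ e · * weight`, which has a sign by assumption. In the borderline case
the integral vanishes, so that `f = f ∘ σ`. -/
lemma isPolarized_of_inner_moment_nonneg {f : E → ℝ} {C : ℝ} (hf : AEStronglyMeasurable f)
    (hC : ∀ x, |f x| ≤ C) {e : E}
    (h : IsPolarized f e ∨ ∀ᵐ x, (f x - f (hyperplaneReflection e x)) * inner ℝ e x ≤ 0)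
    (he : 0 ≤ inner ℝ e (moment f)) : IsPolarized f e := by
  rcases h with h | h
  · exact h
  set k : E → ℝ := fun x => weight x * inner ℝ e x with hk
  have hkσ : ∀ x, k (hyperplaneReflection e x) = -k x := fun x => by
    simp only [hk, inner_hyperplaneReflection, weight, LinearIsometryEquiv.norm_map]; ring
  have hint : Integrable fun x => f x * k x := by
    refine ((integrable_moment hf hC).const_inner e).congr (.of_forall fun x => ?_)
    simp only [hk, inner_smul_right]; ring
  have hM : inner ℝ e (moment f) = ∫ x, f x * k x := by
    rw [moment, ← integral_inner (integrable_moment hf hC) e]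
    congr 1; ext x; simp only [hk, inner_smul_right]; ring
  have hint' : Integrable fun x => f x * k (hyperplaneReflection e x) := by
    simp only [hkσ, mul_neg]
    exact hint.neg
  have key := integral_sub_mul_sub_hyperplaneReflection e hint hint'
  have hσ := (hyperplaneReflection e).measurePreserving
  have hemb := (hyperplaneReflection e).toHomeomorph.measurableEmbedding
  have hfσ : Integrable fun x => f (hyperplaneReflection e x) * k x := by
    have : Integrable fun x => f (hyperplaneReflection e x) * k (hyperplaneReflection e x) :=
      (hσ.integrable_comp_emb hemb).2 hint
    simp only [hkσ, mul_neg] at this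
    exact integrable_neg_iff.1 this
  have hD : Integrable fun x => -((f x - f (hyperplaneReflection e x)) * k x) :=
    ((hint.sub hfσ).congr (.of_forall fun x => by simp; ring)).neg
  have hD0 : 0 ≤ᵐ[volume] fun x => -((f x - f (hyperplaneReflection e x)) * k x) := by
    filter_upwards [h] with x hx
    have := mul_nonneg (weight_pos x).le (neg_nonneg.2 hx)
    simp only [hk, Pi.zero_apply]
    linarith
  have hI : ∫ x, -((f x - f (hyperplaneReflection e x)) * k x) = 0 := by
    refine le_antisymm ?_ (integral_nonneg_of_ae hD0)
    have e1 : ∫ x, (f x - f (hyperplaneReflection e x)) * (k x - k (hyperplaneReflection e x)) =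
        2 * ∫ x, (f x - f (hyperplaneReflection e x)) * k x := by
      rw [← integral_const_mul]
      congr 1; ext x; rw [hkσ]; ring
    simp only [hkσ, mul_neg, integral_neg] at key e1
    rw [integral_neg]
    linarith
  filter_upwards [(integral_eq_zero_iff_of_nonneg_ae hD0 hD).1 hI] with x hx
  simp only [hk, Pi.zero_apply, neg_eq_zero] at hx
  have : (f x - f (hyperplaneReflection e x)) * inner ℝ e x = 0 := by
    have h3 : weight x * ((f x - f (hyperplaneReflection e x)) * inner ℝ e x) = 0 := by
      linarith
    exact (mul_eq_zero.1 h3).resolve_left (weight_pos x).ne'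
  exact this.ge

/-! ### A representative that is monotone everywhere -/

/-- A polarized function has the larger average over the ball on the preferred side. -/
lemma IsPolarized.setIntegral_closedBall_le {f : E → ℝ} (hf : LocallyIntegrable f) {e : E}
    (h : IsPolarized f e) {x : E} (hx : 0 ≤ inner ℝ e x) (δ : ℝ) :
    ∫ y in Metric.closedBall (hyperplaneReflection e x) δ, f y ≤
      ∫ y in Metric.closedBall x δ, f y := by
  set b : E → ℝ := (Metric.closedBall x δ).indicator 1 with hb
  have hbσ : ∀ y, b (hyperplaneReflection e y) =
      (Metric.closedBall (hyperplaneReflection e x) δ).indicator 1 y := fun y => by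
    have : hyperplaneReflection e y ∈ Metric.closedBall x δ ↔
        y ∈ Metric.closedBall (hyperplaneReflection e x) δ := by
      rw [Metric.mem_closedBall, Metric.mem_closedBall,
        ← (hyperplaneReflection e).dist_map y, Submodule.reflection_reflection]
    by_cases hy : y ∈ Metric.closedBall (hyperplaneReflection e x) δ
    · rw [hb, Set.indicator_of_mem (this.2 hy), Set.indicator_of_mem hy]; rfl
    · rw [hb, Set.indicator_of_notMem (mt this.1 hy), Set.indicator_of_notMem hy]
  have hm : ∀ z : E, (fun y => f y * (Metric.closedBall z δ).indicator 1 y) =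
      (Metric.closedBall z δ).indicator f := fun z => by
    ext y; by_cases hy : y ∈ Metric.closedBall z δ <;> simp [hy]
  have hi : ∀ z : E, Integrable fun y => f y * (Metric.closedBall z δ).indicator 1 y := fun z => by
    rw [hm, integrable_indicator_iff Metric.isClosed_closedBall.measurableSet]
    exact hf.integrableOn_isCompact (isCompact_closedBall z δ)
  have hI : ∀ z : E, ∫ y, f y * (Metric.closedBall z δ).indicator 1 y =
      ∫ y in Metric.closedBall z δ, f y := fun z => by
    rw [hm, integral_indicator Metric.isClosed_closedBall.measurableSet]
  have key := integral_sub_mul_sub_hyperplaneReflection (f := f) (k := b) e (hi x)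
    (by simpa only [hbσ] using hi _)
  have hnn : 0 ≤ ∫ y, (f y - f (hyperplaneReflection e y)) *
      (b y - b (hyperplaneReflection e y)) := by
    refine integral_nonneg_of_ae ?_
    filter_upwards [h] with y hy
    have hmono : ∀ z, 0 ≤ inner ℝ e z → b (hyperplaneReflection e z) ≤ b z := fun z hz => by
      by_cases hzb : hyperplaneReflection e z ∈ Metric.closedBall x δ
      · have : z ∈ Metric.closedBall x δ :=
          (dist_le_dist_hyperplaneReflection (mul_nonneg hx hz)).trans hzb
        simp [hb, hzb, this]
      · rw [hb, Set.indicator_of_notMem hzb]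
        exact Set.indicator_nonneg (fun _ _ => zero_le_one) z
    rcases lt_trichotomy (inner ℝ e y) 0 with h0 | h0 | h0
    · have h1 := hmono (hyperplaneReflection e y) (by rw [inner_hyperplaneReflection]; linarith)
      rw [Submodule.reflection_reflection] at h1
      exact mul_nonneg_of_nonpos_of_nonpos (nonpos_of_mul_nonneg_left hy h0) (by linarith)
    · have : hyperplaneReflection e y = y :=
        Submodule.reflection_mem_subspace_eq_self
          (Submodule.mem_orthogonal_singleton_iff_inner_right.2 h0)
      simp [this]
    · exact mul_nonneg (nonneg_of_mul_nonneg_left hy h0) (by linarith [hmono y h0.le])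
  rw [key] at hnn
  have h2 : ∫ y, f y * b (hyperplaneReflection e y) =
      ∫ y in Metric.closedBall (hyperplaneReflection e x) δ, f y := by
    simp only [hbσ]; exact hI _
  rw [h2, hI] at hnn
  linarith

/-- A bounded function that is polarized in every direction of the half-space around `P` agrees
almost everywhere with a function that on every sphere about the origin is a nondecreasing
function of `inner ℝ P ·`. The representative is the upper limit of the averages over balls. -/
lemma exists_ae_eq_monotone {f : E → ℝ} {C : ℝ} (hf : AEStronglyMeasurable f)
    (hC : ∀ x, |f x| ≤ C) {P : E}
    (h : ∀ e : E, e ≠ 0 → 0 ≤ inner ℝ P e → IsPolarized f e) :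
    ∃ F : E → ℝ, F =ᵐ[volume] f ∧
      ∀ x y, ‖x‖ = ‖y‖ → inner ℝ P y ≤ inner ℝ P x → F y ≤ F x := by
  have hloc : LocallyIntegrable f := by
    refine (locallyIntegrable_const C).mono hf (.of_forall fun x => ?_)
    rw [Real.norm_eq_abs, Real.norm_eq_abs]
    exact (hC x).trans (le_abs_self C)
  set δ : ℕ → ℝ := fun n => 1 / ((n : ℝ) + 1) with hδ
  set A : ℕ → E → ℝ := fun n x => ⨍ y in Metric.closedBall x (δ n), f y with hA
  have hbdd : ∀ n x, |A n x| ≤ C := fun n x => by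
    have hpos : 0 < volume.real (Metric.closedBall x (δ n)) :=
      ENNReal.toReal_pos (Metric.measure_closedBall_pos _ _ Nat.one_div_pos_of_nat).ne'
        measure_closedBall_lt_top.ne
    have h1 : ‖∫ y in Metric.closedBall x (δ n), f y‖ ≤
        C * volume.real (Metric.closedBall x (δ n)) :=
      norm_setIntegral_le_of_norm_le_const measure_closedBall_lt_top fun y _ => hC y
    rw [hA]
    simp only
    rw [setAverage_eq, smul_eq_mul, abs_mul, abs_of_pos (inv_pos.2 hpos), inv_mul_le_iff₀ hpos,
      mul_comm]
    exact h1
  refine ⟨fun x => Filter.limsup (fun n => A n x) Filter.atTop, ?_, fun x y hxy hP => ?_⟩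
  · filter_upwards [IsUnifLocDoublingMeasure.ae_tendsto_average volume hloc 1] with x hx
    refine (hx (l := Filter.atTop) (fun _ : ℕ => x) δ ?_ (.of_forall fun n => ?_)).limsup_eq
    · exact tendsto_nhdsWithin_iff.2 ⟨tendsto_one_div_add_atTop_nhds_zero_nat,
        .of_forall fun n => Set.mem_Ioi.2 Nat.one_div_pos_of_nat⟩
    · exact Metric.mem_closedBall_self (by rw [one_mul]; exact Nat.one_div_pos_of_nat.le)
  · refine Filter.limsup_le_limsup (.of_forall fun n => ?_)
      (Filter.isCoboundedUnder_le_of_le Filter.atTop fun n => (abs_le.1 (hbdd n y)).1)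
      (Filter.isBoundedUnder_of ⟨C, fun n => (abs_le.1 (hbdd n x)).2⟩)
    rcases eq_or_ne x y with rfl | hne
    · exact le_rfl
    have hσ : hyperplaneReflection (x - y) x = y := Submodule.reflection_sub hxy
    have hpol := h (x - y) (sub_ne_zero.2 hne) (by rw [inner_sub_right]; linarith)
    have hx : 0 ≤ inner ℝ (x - y) x := by
      rw [inner_sub_left, real_inner_self_eq_norm_sq, sq]
      have := real_inner_le_norm y x
      rw [← hxy] at this
      linarith
    have hle := hpol.setIntegral_closedBall_le hloc hx (δ n)
    rw [hσ] at hle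
    have hvol : volume.real (Metric.closedBall y (δ n)) =
        volume.real (Metric.closedBall x (δ n)) := by
      rw [Measure.real, Measure.real, Measure.addHaar_closedBall_center,
        Measure.addHaar_closedBall_center volume x]
    simp only [hA]
    rw [setAverage_eq, setAverage_eq, hvol]
    exact smul_le_smul_of_nonneg_left hle (inv_nonneg.2 measureReal_nonneg)

end Polarization

/-! ### Polar coordinates -/

section Polar

variable {E : Type*} [NormedAddCommGroup E] [InnerProductSpace ℝ E]

/-- The action of a linear isometry on the unit sphere. -/
def sphereEquiv (ρ : E ≃ₗᵢ[ℝ] E) :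
    Metric.sphere (0 : E) 1 ≃ₜ Metric.sphere (0 : E) 1 :=
  ρ.toHomeomorph.subtype fun x => by simp

lemma coe_sphereEquiv (ρ : E ≃ₗᵢ[ℝ] E) (ω : Metric.sphere (0 : E) 1) :
    (sphereEquiv ρ ω : E) = ρ ω := rfl

variable [FiniteDimensional ℝ E] [MeasurableSpace E] [BorelSpace E]

/-- What holds almost everywhere holds on almost every sphere about the origin, almost
everywhere for the surface measure. -/
lemma ae_ae_toSphere_of_ae {p : E → Prop} (h : ∀ᵐ x, p x) :
    ∀ᵐ r : Set.Ioi (0 : ℝ) ∂(Measure.volumeIoiPow (Module.finrank ℝ E - 1)),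
      ∀ᵐ ω : Metric.sphere (0 : E) 1 ∂(volume : Measure E).toSphere, p ((r : ℝ) • (ω : E)) := by
  have h1 : ∀ᵐ x : ({0}ᶜ : Set E) ∂((volume : Measure E).comap (↑)), p x :=
    (ae_restrict_iff_subtype (measurableSet_singleton (0 : E)).compl).1 (ae_restrict_of_ae h)
  have hmp := (volume : Measure E).measurePreserving_homeomorphUnitSphereProd
  have h2 := (hmp.symm (homeomorphUnitSphereProd E).toMeasurableEquiv).quasiMeasurePreserving.ae h1
  exact Measure.ae_ae_of_ae_prod (Measure.measurePreserving_swap.quasiMeasurePreserving.ae h2)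

/-- What holds for almost every radius holds for the norm of almost every point. -/
lemma ae_norm_of_ae_volumeIoiPow [Nontrivial E] {q : ℝ → Prop}
    (h : ∀ᵐ r : Set.Ioi (0 : ℝ) ∂(Measure.volumeIoiPow (Module.finrank ℝ E - 1)), q (r : ℝ)) :
    ∀ᵐ x : E, q ‖x‖ := by
  have hmp := (volume : Measure E).measurePreserving_homeomorphUnitSphereProd
  have h1 := hmp.quasiMeasurePreserving.ae (Measure.quasiMeasurePreserving_snd.ae h)
  have h2 : ∀ᵐ x : E ∂volume.restrict {0}ᶜ, q ‖x‖ :=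
    (ae_restrict_iff_subtype (measurableSet_singleton (0 : E)).compl).2 <| by
      simpa only [homeomorphUnitSphereProd_apply_snd_coe] using h1
  rwa [restrict_compl_singleton] at h2

lemma ae_restrict_Ioi_of_ae_volumeIoiPow {n : ℕ} {q : ℝ → Prop}
    (h : ∀ᵐ r : Set.Ioi (0 : ℝ) ∂(Measure.volumeIoiPow n), q (r : ℝ)) :
    ∀ᵐ r ∂(volume.restrict (Set.Ioi (0 : ℝ))), q r := by
  rw [Measure.volumeIoiPow, ae_withDensity_iff (by fun_prop)] at h
  rw [ae_restrict_iff_subtype measurableSet_Ioi]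
  filter_upwards [h] with r hr
  exact hr (by simpa using pow_pos r.2 n)

open scoped Pointwise in
/-- The surface measure of the unit sphere is invariant under linear isometries. -/
lemma measurePreserving_sphereEquiv (ρ : E ≃ₗᵢ[ℝ] E) :
    MeasurePreserving (sphereEquiv ρ) (volume : Measure E).toSphere
      (volume : Measure E).toSphere := by
  refine ⟨(sphereEquiv ρ).measurable, Measure.ext fun s hs => ?_⟩
  rw [Measure.map_apply (sphereEquiv ρ).measurable hs, Measure.toSphere_apply' _ hs,
    Measure.toSphere_apply' _ ((sphereEquiv ρ).measurable hs),
    ← ρ.measurePreserving.measure_preimage_emb ρ.toHomeomorph.measurableEmbedding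
      (Set.Ioo (0 : ℝ) 1 • (Subtype.val '' s))]
  congr 2
  ext x
  simp only [Set.mem_smul, Set.mem_image, Set.mem_preimage]
  constructor
  · rintro ⟨r, hr, _, ⟨ω, hω, rfl⟩, rfl⟩
    exact ⟨r, hr, _, ⟨_, hω, rfl⟩, by rw [coe_sphereEquiv, map_smul]⟩
  · rintro ⟨r, hr, _, ⟨ω, hω, rfl⟩, hx⟩
    refine ⟨r, hr, _, ⟨(sphereEquiv ρ).symm ω, by simpa using hω, rfl⟩, ρ.injective ?_⟩
    rw [← hx, map_smul, ← coe_sphereEquiv, Homeomorph.apply_symm_apply]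

lemma toSphere_setOf_eq_of_ae_iff (ρ : E ≃ₗᵢ[ℝ] E) {p q : E → Prop} {r : ℝ}
    (h : ∀ᵐ ω : Metric.sphere (0 : E) 1 ∂(volume : Measure E).toSphere,
      (p (ρ (r • (ω : E))) ↔ q (r • (ω : E)))) :
    (volume : Measure E).toSphere {ω | p (r • (ω : E))} =
      (volume : Measure E).toSphere {ω | q (r • (ω : E))} := by
  rw [← (measurePreserving_sphereEquiv ρ).measure_preimage_emb
    (sphereEquiv ρ).measurableEmbedding]
  refine measure_congr ?_
  filter_upwards [h] with ω hω
  rw [map_smul] at hω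
  exact propext hω

end Polar

/-! ### Rotations -/

/-- In dimension at least two the rotations act transitively on the unit sphere. -/
lemma exists_rotation {N : ℕ} [NeZero N] (hN : 2 ≤ N) {P : EuclideanSpace ℝ (Fin N)}
    (hP : ‖P‖ = 1) :
    ∃ ρ : EuclideanSpace ℝ (Fin N) ≃ₗᵢ[ℝ] EuclideanSpace ℝ (Fin N),
      LinearMap.det (ρ.toLinearEquiv : EuclideanSpace ℝ (Fin N) →ₗ[ℝ] EuclideanSpace ℝ (Fin N))
        = 1 ∧ ρ (northPole N) = P := by
  have hdet : ∀ e : EuclideanSpace ℝ (Fin N), e ≠ 0 →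
      LinearMap.det ((sigmaH e).toLinearEquiv :
        EuclideanSpace ℝ (Fin N) →ₗ[ℝ] EuclideanSpace ℝ (Fin N)) = -1 := fun e he => by
    have h := Submodule.det_reflection (𝕜 := ℝ) (Submodule.span ℝ {e})ᗮ
    rw [Submodule.orthogonal_orthogonal, finrank_span_singleton he, pow_one] at h
    exact h
  have hn : ‖northPole N‖ = 1 := by simp [northPole]
  rcases eq_or_ne (northPole N) P with h | h
  · exact ⟨LinearIsometryEquiv.refl ℝ _, LinearMap.det_id, h⟩
  -- The first reflection fixes the north pole and only corrects the determinant.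
  set e₁ : EuclideanSpace ℝ (Fin N) := EuclideanSpace.single ⟨1, hN⟩ 1
  have h01 : (0 : Fin N) ≠ ⟨1, hN⟩ := fun h => by simpa using congrArg Fin.val h
  refine ⟨(sigmaH e₁).trans (sigmaH (northPole N - P)), ?_, ?_⟩
  · have h1 := hdet (northPole N - P) (sub_ne_zero.2 h)
    have h2 := hdet e₁ (by simp [e₁])
    have := LinearMap.det_comp
      ((sigmaH (northPole N - P)).toLinearEquiv :
        EuclideanSpace ℝ (Fin N) →ₗ[ℝ] EuclideanSpace ℝ (Fin N))
      ((sigmaH e₁).toLinearEquiv :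
        EuclideanSpace ℝ (Fin N) →ₗ[ℝ] EuclideanSpace ℝ (Fin N))
    rw [h1, h2, neg_mul_neg, one_mul] at this
    exact this
  · have hfix : sigmaH e₁ (northPole N) = northPole N := by
      refine Submodule.reflection_mem_subspace_eq_self
        (Submodule.mem_orthogonal_singleton_iff_inner_right.2 ?_)
      simp [e₁, northPole, EuclideanSpace.inner_single_left, h01.symm]
    rw [LinearIsometryEquiv.trans_apply, hfix]
    exact Submodule.reflection_sub (hn.trans hP.symm)

/-! ### Reading the polarization hypothesis -/

/-- A function that equals its two-point rearrangement is polarized; if instead its reflection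
equals the rearrangement, the function is polarized in the opposite direction. -/
lemma sign_of_twoPoint {N : ℕ} {v : EuclideanSpace ℝ (Fin N) → ℝ} {e : EuclideanSpace ℝ (Fin N)}
    {φ : ℝ → ℝ} (hφ : Monotone φ)
    (h : v =ᵐ[volume] twoPoint e v ∨ (fun x => v (sigmaH e x)) =ᵐ[volume] twoPoint e v) :
    IsPolarized (φ ∘ v) e ∨
      ∀ᵐ x, ((φ ∘ v) x - (φ ∘ v) (hyperplaneReflection e x)) * inner ℝ e x ≤ 0 := by
  have hσ : ∀ x, hyperplaneReflection e x = sigmaH e x := fun _ => rfl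
  refine h.imp (fun h => ?_) (fun h => ?_)
  all_goals
    filter_upwards [h] with x hx
    simp only [Function.comp_apply, hσ]
    by_cases hxe : x ∈ halfSpace e
    · have h0 : 0 ≤ inner ℝ e x := le_of_lt hxe
      simp only [twoPoint, if_pos hxe] at hx
      first
      | exact mul_nonneg (sub_nonneg.2 (hφ (hx ▸ le_max_right _ _))) h0
      | exact mul_nonpos_of_nonpos_of_nonneg (sub_nonpos.2 (hφ (hx ▸ le_max_left _ _))) h0
    · have h0 : inner ℝ e x ≤ 0 := not_lt.1 hxe
      simp only [twoPoint, if_neg hxe] at hx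
      first
      | exact mul_nonneg_of_nonpos_of_nonpos (sub_nonpos.2 (hφ (hx ▸ min_le_right _ _))) h0
      | exact mul_nonpos_of_nonneg_of_nonpos (sub_nonneg.2 (hφ (hx ▸ min_le_left _ _))) h0

/-- If for every hyperplane through the origin a bounded function is polarized in one of the two
normal directions, then all the preferred directions lie in the half-space around a single
point of the sphere, the direction of the weighted first moment. -/
lemma exists_pole {E : Type*} [NormedAddCommGroup E] [InnerProductSpace ℝ E]
    [FiniteDimensional ℝ E] [MeasurableSpace E] [BorelSpace E] [Nontrivial E]
    {f : E → ℝ} {C : ℝ} (hf : AEStronglyMeasurable f) (hC : ∀ x, |f x| ≤ C)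
    (h : ∀ e : E, ‖e‖ = 1 → IsPolarized f e ∨
      ∀ᵐ x, (f x - f (hyperplaneReflection e x)) * inner ℝ e x ≤ 0) :
    ∃ P : E, ‖P‖ = 1 ∧ ∀ e : E, e ≠ 0 → 0 ≤ inner ℝ P e → IsPolarized f e := by
  -- If the moment vanishes, `f` is invariant under all reflections and any `P` will do.
  obtain ⟨P, hP, hPM⟩ : ∃ P : E, ‖P‖ = 1 ∧ moment f = ‖moment f‖ • P := by
    by_cases hM : moment f = 0
    · obtain ⟨P, hP⟩ := exists_norm_eq E zero_le_one
      exact ⟨P, hP, by simp [hM]⟩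
    · have hM' : ‖moment f‖ ≠ 0 := norm_ne_zero_iff.2 hM
      exact ⟨‖moment f‖⁻¹ • moment f, by rw [norm_smul, norm_inv, norm_norm, inv_mul_cancel₀ hM'],
        by rw [smul_inv_smul₀ hM']⟩
  refine ⟨P, hP, fun e he hPe => ?_⟩
  have hpos : 0 < ‖e‖ := norm_pos_iff.2 he
  have hpol : IsPolarized f (‖e‖⁻¹ • e) := by
    refine isPolarized_of_inner_moment_nonneg hf hC
      (h _ (by rw [norm_smul, norm_inv, norm_norm, inv_mul_cancel₀ hpos.ne'])) ?_
    rw [hPM, real_inner_smul_left, inner_smul_right, real_inner_comm]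
    positivity
  filter_upwards [hpol] with x hx
  rw [hyperplaneReflection_smul (inv_ne_zero hpos.ne'), real_inner_smul_left, mul_left_comm] at hx
  exact nonneg_of_mul_nonneg_right hx (inv_pos.2 hpos)

/-! ### The profile -/

section Profile

variable {N : ℕ} [NeZero N]

lemma norm_northPole : ‖northPole N‖ = 1 := by simp [northPole]

lemma inner_northPole (x : EuclideanSpace ℝ (Fin N)) : inner ℝ (northPole N) x = x 0 := by
  simp [northPole, EuclideanSpace.inner_single_left]

/-- The point with polar coordinates `(r, θ)` on the meridian through a unit vector `e₁`. -/
noncomputable def meridian (e₁ : EuclideanSpace ℝ (Fin N)) (r θ : ℝ) :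
    EuclideanSpace ℝ (Fin N) :=
  r • (Real.cos θ • northPole N + Real.sin θ • e₁)

variable {e₁ : EuclideanSpace ℝ (Fin N)}

lemma norm_meridian (he : ‖e₁‖ = 1) (he0 : e₁ 0 = 0) {r : ℝ} (hr : 0 ≤ r) (θ : ℝ) :
    ‖meridian e₁ r θ‖ = r := by
  have h : ‖Real.cos θ • northPole N + Real.sin θ • e₁‖ = 1 := by
    refine (sq_eq_sq₀ (norm_nonneg _) zero_le_one).1 ?_
    rw [norm_add_sq_real, norm_smul, norm_smul, norm_northPole, he, inner_smul_left,
      inner_smul_right, inner_northPole, he0, Real.norm_eq_abs, Real.norm_eq_abs, mul_one, mul_one,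
      sq_abs, sq_abs]
    simp
  rw [meridian, norm_smul, h, mul_one, Real.norm_of_nonneg hr]

lemma meridian_apply_zero (he0 : e₁ 0 = 0) (r θ : ℝ) :
    meridian e₁ r θ 0 = r * Real.cos θ := by
  simp [meridian, northPole, he0]

/-- The profile `w (r, θ)` of a function `F` with values in `[-π/2, π/2]`, transported back by `tan`.
On radii where `F` attains an endpoint of the interval at an interior angle, the value is the
junk value zero. -/
noncomputable def profile (e₁ : EuclideanSpace ℝ (Fin N)) (F : EuclideanSpace ℝ (Fin N) → ℝ)
    (r θ : ℝ) : ℝ :=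
  open Classical in
  if ∀ t ∈ Set.Ioo 0 Real.pi, F (meridian e₁ r t) ∈ Set.Ioo (-(Real.pi / 2)) (Real.pi / 2)
  then Real.tan (F (meridian e₁ r θ)) else 0

variable {F : EuclideanSpace ℝ (Fin N) → ℝ}

lemma antitoneOn_profile (he : ‖e₁‖ = 1) (he0 : e₁ 0 = 0)
    (hF : ∀ x y, ‖x‖ = ‖y‖ → y 0 ≤ x 0 → F y ≤ F x) {r : ℝ} (hr : 0 ≤ r) :
    AntitoneOn (profile e₁ F r) (Set.Ioo 0 Real.pi) := by
  intro s hs t ht hst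
  unfold profile
  split_ifs with h
  · refine Real.strictMonoOn_tan.monotoneOn (h t ht) (h s hs) (hF _ _ ?_ ?_)
    · rw [norm_meridian he he0 hr, norm_meridian he he0 hr]
    · rw [meridian_apply_zero he0, meridian_apply_zero he0]
      exact mul_le_mul_of_nonneg_left
        (Real.antitoneOn_cos ⟨hs.1.le, hs.2.le⟩ ⟨ht.1.le, ht.2.le⟩ hst) hr
  · exact le_rfl

/-- On a sphere that carries almost no point where `F` attains `π/2` or `-π/2`, monotonicity keeps `F`
off these values at all interior angles, because spherical caps have positive measure. -/
lemma profile_eq_tan (he : ‖e₁‖ = 1) (he0 : e₁ 0 = 0)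
    (hF : ∀ x y, ‖x‖ = ‖y‖ → y 0 ≤ x 0 → F y ≤ F x) {r : ℝ} (hr : 0 < r)
    (hgood : ∀ᵐ ω : Metric.sphere (0 : EuclideanSpace ℝ (Fin N)) 1
      ∂(volume : Measure (EuclideanSpace ℝ (Fin N))).toSphere,
      F (r • (ω : EuclideanSpace ℝ (Fin N))) ∈ Set.Ioo (-(Real.pi / 2)) (Real.pi / 2)) (θ : ℝ) :
    profile e₁ F r θ = Real.tan (F (meridian e₁ r θ)) := by
  have hcont : Continuous fun ω : Metric.sphere (0 : EuclideanSpace ℝ (Fin N)) 1 =>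
      (ω : EuclideanSpace ℝ (Fin N)) 0 := by fun_prop
  have hmem : ∀ {U : Set (Metric.sphere (0 : EuclideanSpace ℝ (Fin N)) 1)}, IsOpen U → U.Nonempty →
      ∃ ω ∈ U, F (r • (ω : EuclideanSpace ℝ (Fin N))) ∈
        Set.Ioo (-(Real.pi / 2)) (Real.pi / 2) := fun hU hne => by
    obtain ⟨ω, hω, h⟩ := (Measure.dense_of_ae hgood).inter_open_nonempty _ hU hne
    exact ⟨ω, hω, h⟩
  have hnorm : ∀ (ω : Metric.sphere (0 : EuclideanSpace ℝ (Fin N)) 1) (t : ℝ),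
      ‖r • (ω : EuclideanSpace ℝ (Fin N))‖ = ‖meridian e₁ r t‖ := fun ω t => by
    rw [norm_meridian he he0 hr.le, norm_smul, norm_eq_of_mem_sphere, mul_one,
      Real.norm_of_nonneg hr.le]
  rw [profile, if_pos]
  intro t ht
  have hcos1 : Real.cos t < 1 := by
    simpa using Real.cos_lt_cos_of_nonneg_of_le_pi le_rfl ht.2.le ht.1
  have hcos2 : -1 < Real.cos t := by
    simpa using Real.cos_lt_cos_of_nonneg_of_le_pi ht.1.le le_rfl ht.2
  constructor
  · obtain ⟨ω, hω, hFω⟩ := hmem (isOpen_lt hcont (continuous_const (y := Real.cos t)))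
      ⟨⟨-northPole N, by simp [norm_northPole]⟩, by simpa [northPole] using hcos2⟩
    refine hFω.1.trans_le (hF _ _ (hnorm ω t).symm ?_)
    rw [meridian_apply_zero he0, PiLp.smul_apply, smul_eq_mul]
    exact mul_le_mul_of_nonneg_left (le_of_lt hω) hr.le
  · obtain ⟨ω, hω, hFω⟩ := hmem (isOpen_lt (continuous_const (y := Real.cos t)) hcont)
      ⟨⟨northPole N, by simp [norm_northPole]⟩, by simpa [northPole] using hcos1⟩
    refine (hF _ _ (hnorm ω t) ?_).trans_lt hFω.2
    rw [meridian_apply_zero he0, PiLp.smul_apply, smul_eq_mul]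
    exact mul_le_mul_of_nonneg_left (le_of_lt hω) hr.le

/-- A function that is monotone in the first coordinate on spheres about the origin depends
on the radius and the polar angle only. -/
lemma apply_meridian_arccos (he : ‖e₁‖ = 1) (he0 : e₁ 0 = 0)
    (hF : ∀ x y, ‖x‖ = ‖y‖ → y 0 ≤ x 0 → F y ≤ F x) (x : EuclideanSpace ℝ (Fin N)) :
    F (meridian e₁ ‖x‖ (Real.arccos (x 0 / ‖x‖))) = F x := by
  have h1 : ‖meridian e₁ ‖x‖ (Real.arccos (x 0 / ‖x‖))‖ = ‖x‖ :=
    norm_meridian he he0 (norm_nonneg x) _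
  have h2 : meridian e₁ ‖x‖ (Real.arccos (x 0 / ‖x‖)) 0 = x 0 := by
    have hx0 : |x 0| ≤ ‖x‖ := PiLp.norm_apply_le x 0
    have hle : |x 0 / ‖x‖| ≤ 1 := by
      rw [abs_div, abs_norm]; exact div_le_one_of_le₀ hx0 (norm_nonneg x)
    rw [meridian_apply_zero he0, Real.cos_arccos (abs_le.1 hle).1 (abs_le.1 hle).2]
    rcases eq_or_ne x 0 with rfl | hx
    · simp
    · exact mul_div_cancel₀ _ (norm_ne_zero_iff.2 hx)
  exact le_antisymm (hF _ _ h1.symm h2.le) (hF _ _ h1 h2.ge)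

end Profile

/-! ### Equimeasurability -/

/-- A function that agrees almost everywhere with a rotation of `u` is equimeasurable with `u`
on almost every sphere about the origin. -/
lemma equimeasurable_of_ae_eq {N : ℕ} {Ω : Set (EuclideanSpace ℝ (Fin N))}
    (hΩ : IsRadialDomain Ω) {u v : EuclideanSpace ℝ (Fin N) → ℝ}
    (ρ : EuclideanSpace ℝ (Fin N) ≃ₗᵢ[ℝ] EuclideanSpace ℝ (Fin N))
    (h : (fun x => u (ρ x)) =ᵐ[volume.restrict Ω] v) :
    ∀ᵐ r : ℝ ∂(volume.restrict (Set.Ioi (0 : ℝ))), ∀ a b : ℝ, a < b →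
      (volume : Measure (EuclideanSpace ℝ (Fin N))).toSphere
          {ω | r • (ω : EuclideanSpace ℝ (Fin N)) ∈ Ω ∧
            a < u (r • (ω : EuclideanSpace ℝ (Fin N))) ∧
            u (r • (ω : EuclideanSpace ℝ (Fin N))) ≤ b} =
        (volume : Measure (EuclideanSpace ℝ (Fin N))).toSphere
          {ω | r • (ω : EuclideanSpace ℝ (Fin N)) ∈ Ω ∧
            a < v (r • (ω : EuclideanSpace ℝ (Fin N))) ∧
            v (r • (ω : EuclideanSpace ℝ (Fin N))) ≤ b} := by
  have h1 : ∀ᵐ x, x ∈ Ω → u (ρ x) = v x := (ae_restrict_iff' hΩ.isOpen.measurableSet).1 h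
  have h2 := ae_restrict_Ioi_of_ae_volumeIoiPow
    (q := fun r => ∀ᵐ ω : Metric.sphere (0 : EuclideanSpace ℝ (Fin N)) 1
      ∂(volume : Measure (EuclideanSpace ℝ (Fin N))).toSphere,
      r • (ω : EuclideanSpace ℝ (Fin N)) ∈ Ω →
        u (ρ (r • (ω : EuclideanSpace ℝ (Fin N)))) = v (r • (ω : EuclideanSpace ℝ (Fin N))))
    (ae_ae_toSphere_of_ae (p := fun x => x ∈ Ω → u (ρ x) = v x) h1)
  filter_upwards [h2] with r hr a b _
  refine toSphere_setOf_eq_of_ae_iff ρ (p := fun x => x ∈ Ω ∧ a < u x ∧ u x ≤ b)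
    (q := fun x => x ∈ Ω ∧ a < v x ∧ v x ≤ b) ?_
  filter_upwards [hr] with ω hω
  have hiff : ρ (r • (ω : EuclideanSpace ℝ (Fin N))) ∈ Ω ↔
      r • (ω : EuclideanSpace ℝ (Fin N)) ∈ Ω :=
    ⟨hΩ.radial _ _ (ρ.norm_map _), hΩ.radial _ _ (ρ.norm_map _).symm⟩
  rw [hiff]
  refine and_congr_right fun hmem => ?_
  rw [hω hmem]

end FoliatedSchwarz

open FoliatedSchwarz in
theorem mainTheorem2 {N : ℕ} [NeZero N] (hN : 2 ≤ N)
    (Ω : Set (EuclideanSpace ℝ (Fin N))) (hΩ : IsRadialDomain Ω)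
    (p : ENNReal) (hp1 : 1 ≤ p) (hp : p ≠ ⊤)
    (u : EuclideanSpace ℝ (Fin N) → ℝ) (hu : MemLp u p (volume.restrict Ω))
    (hH : ∀ e : EuclideanSpace ℝ (Fin N), ‖e‖ = 1 →
      Ω.indicator u =ᵐ[volume] twoPoint e (Ω.indicator u) ∨
      (fun x => Ω.indicator u (sigmaH e x)) =ᵐ[volume] twoPoint e (Ω.indicator u)) :
    ∃ P ∈ Metric.sphere (0 : EuclideanSpace ℝ (Fin N)) 1,
      IsFoliatedSchwarzSymmetric Ω u P := by
  -- `arctan` makes the function bounded, hence locally integrable, and preserves all comparisons.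
  set f : EuclideanSpace ℝ (Fin N) → ℝ := Real.arctan ∘ Ω.indicator u with hfdef
  have hf : AEStronglyMeasurable f volume :=
    Real.continuous_arctan.comp_aestronglyMeasurable
      ((aestronglyMeasurable_indicator_iff hΩ.isOpen.measurableSet).2 hu.1)
  have hfIoo : ∀ x, f x ∈ Set.Ioo (-(Real.pi / 2)) (Real.pi / 2) := fun x =>
    Real.arctan_mem_Ioo _
  have hC : ∀ x, |f x| ≤ Real.pi / 2 := fun x => abs_le.2 ⟨(hfIoo x).1.le, (hfIoo x).2.le⟩
  set e₁ : EuclideanSpace ℝ (Fin N) := EuclideanSpace.single ⟨1, hN⟩ 1 with he₁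
  have he : ‖e₁‖ = 1 := by simp [he₁]
  have he0 : e₁ 0 = 0 := by
    have h01 : (0 : Fin N) ≠ ⟨1, hN⟩ := fun h => by simpa using congrArg Fin.val h
    simp [he₁, h01]
  have : Nontrivial (EuclideanSpace ℝ (Fin N)) :=
    ⟨e₁, 0, fun h => by simp [h] at he⟩
  obtain ⟨P, hP, hpol⟩ := exists_pole hf hC fun e h1 =>
    sign_of_twoPoint Real.arctan_strictMono.monotone (hH e h1)
  obtain ⟨F, hFf, hFmono⟩ := exists_ae_eq_monotone hf hC hpol
  obtain ⟨ρ, hdet, hρ⟩ := exists_rotation hN hP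
  have hmono : ∀ x y, ‖x‖ = ‖y‖ → y 0 ≤ x 0 → (F ∘ ρ) y ≤ (F ∘ ρ) x := fun x y hxy h => by
    refine hFmono _ _ (by simpa using hxy) ?_
    rwa [← hρ, ρ.inner_map_map, ρ.inner_map_map, inner_northPole, inner_northPole]
  have hFρ : ∀ᵐ x, (F ∘ ρ) x = f (ρ x) := ρ.measurePreserving.quasiMeasurePreserving.ae hFf
  have hgood : ∀ᵐ x : EuclideanSpace ℝ (Fin N),
      ∀ᵐ ω : Metric.sphere (0 : EuclideanSpace ℝ (Fin N)) 1
        ∂(volume : Measure (EuclideanSpace ℝ (Fin N))).toSphere,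
      (F ∘ ρ) (‖x‖ • (ω : EuclideanSpace ℝ (Fin N))) ∈
        Set.Ioo (-(Real.pi / 2)) (Real.pi / 2) := by
    refine ae_norm_of_ae_volumeIoiPow (q := fun r =>
      ∀ᵐ ω : Metric.sphere (0 : EuclideanSpace ℝ (Fin N)) 1
        ∂(volume : Measure (EuclideanSpace ℝ (Fin N))).toSphere,
      (F ∘ ρ) (r • (ω : EuclideanSpace ℝ (Fin N))) ∈
        Set.Ioo (-(Real.pi / 2)) (Real.pi / 2))
      (ae_ae_toSphere_of_ae (p := fun x => (F ∘ ρ) x ∈ Set.Ioo (-(Real.pi / 2)) (Real.pi / 2)) ?_)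
    filter_upwards [hFρ] with x hx
    rw [hx]
    exact hfIoo _
  set v : EuclideanSpace ℝ (Fin N) → ℝ := fun x =>
    profile e₁ (F ∘ ρ) ‖x‖ (Real.arccos (x 0 / ‖x‖)) with hv
  have huv : (fun x => u (ρ x)) =ᵐ[volume.restrict Ω] v := by
    refine (ae_restrict_iff' hΩ.isOpen.measurableSet).2 ?_
    have hne : ∀ᵐ x : EuclideanSpace ℝ (Fin N), x ≠ 0 := Measure.ae_ne volume 0
    filter_upwards [hFρ, hgood, hne] with x hx hg hx0 hxΩ
    have hρΩ : ρ x ∈ Ω := hΩ.radial _ _ (by simp) hxΩ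
    simp only [hv]
    rw [profile_eq_tan he he0 hmono (norm_pos_iff.2 hx0) hg, apply_meridian_arccos he he0 hmono, hx,
      hfdef, Function.comp_apply, Real.tan_arctan, Set.indicator_of_mem hρΩ]
  exact ⟨P, by simpa using hP, ρ, hdet, hρ, v,
    ⟨⟨profile e₁ (F ∘ ρ), fun r hr => antitoneOn_profile he he0 hmono hr, fun x _ => rfl⟩,
      equimeasurable_of_ae_eq hΩ ρ huv⟩, huv⟩
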